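/- The Wiener index $W(G)$ of a finite connected graph $G$ is the sum of the distances over all unordered pairs of vertices of $G$, and $\mathfrak{T}_n(d)$ denotes the family of all trees on $n$ vertices with diameter $d$. Let $n\ge 10$ and let $P: v_0v_1\cdots v_{n-5}$ be a path of length $n-5$. Define the following trees on $n$ vertices. - $T_{11}=T_{11}(n)$ is obtained from $P$ by attaching two pendant vertices at $v_1$ and two pendant vertices at $v_{n-6}$. - $T_{13}=T_{13}(n)$ is obtained from $P$ by attaching one pendant vertex at $v_1$, one pendant vertex at $v_{n-6}$, and a path with two new vertices at $v_2$ (that is, new vertices $a,b$ with edges $v_2a$, $ab$). - $T_{18}=T_{18}(n)$, for $n\ge 11$, is obtained from $P$ by attaching one pendant vertex at $v_{n-6}$ and a path with three new vertices at $v_3$ (that is, new vertices $a,b,c$ with edges $v_3a$, $ab$, $bc$). Then, up to isomorphism: - for every $n\ge 12$, $T_{11}(n)$ is the unique tree maximising the Wiener index in $\mathfrak{T}_n(n-5)$; - the trees maximising the Wiener index in $\mathfrak{T}_{10}(5)$ are exactly the two non-isomorphic trees $T_{11}(10)$ and $T_{13}(10)$; - the trees maximising the Wiener index in $\mathfrak{T}_{11}(6)$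 are exactly the two non-isomorphic trees $T_{11}(11)$ and $T_{18}(11)$. -/

import Mathlib

/-- The Wiener index: the sum of the distances over all unordered pairs of vertices
(the pairs `s(v, v)` contribute `0`). -/
noncomputable def wienerIndex {V : Type*} [Fintype V] (G : SimpleGraph V) : ℕ :=
  ∑ e : Sym2 V, Sym2.lift ⟨fun u v => G.dist u v, fun _ _ => G.dist_comm⟩ e

/-- Summing over ordered pairs counts every distance twice. -/
theorem sum_dist_eq_two_mul_wienerIndex {V : Type*} [Fintype V] (G : SimpleGraph V) : ∑ u, ∑ v, G.dist u v = 2 * wienerIndex G := by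
  classical
  unfold wienerIndex
  rw [← Fintype.sum_prod_type', ← Finset.sum_fiberwise (s := Finset.univ) (g := fun p : V × V => s(p.1,p.2)), Finset.mul_sum]
  refine Finset.sum_congr rfl fun e _ => ?_
  induction e with | _ a b =>
  by_cases h : a = b
  · subst h
    rw [Finset.sum_eq_zero]; · simp
    intro p hp; simp at hp; simp [hp]
  · have : (Finset.univ.filter fun p : V × V => s(p.1,p.2) = s(a,b)) = {(a,b),(b,a)} := by
      ext ⟨x,y⟩; simp
    rw [this, Finset.sum_pair (by simp [h]), G.dist_comm (u := b)]; simp [two_mul]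

/-- `G` is a tree on `n` vertices with diameter `d`. -/
def IsTreeOfDiam {V : Type*} [Fintype V] (G : SimpleGraph V) (n d : ℕ) : Prop :=
  G.IsTree ∧ Fintype.card V = n ∧ G.diam = d

/-- `G` is a tree on `n` vertices with diameter `d` whose Wiener index is the largest one
among all trees on `n` vertices with diameter `d`. (Up to isomorphism each of these has the
vertex set `Fin n`.) -/
def IsWienerMaximalTree {V : Type*} [Fintype V] (G : SimpleGraph V) (n d : ℕ) : Prop :=
  IsTreeOfDiam G n d ∧
    ∀ H : SimpleGraph (Fin n), IsTreeOfDiam H n d → wienerIndex H ≤ wienerIndex G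

/-- The graph on the vertices `0, …, n - 1` whose edges are those of the path
`v_0 v_1 ⋯ v_{n-5}`, where `v_i = i`, and the edges in the list `E`.
The vertices outside the path are `n - 4, n - 3, n - 2, n - 1`. -/
def pathWithEdges (n : ℕ) (E : List (ℕ × ℕ)) : SimpleGraph (Fin n) :=
  SimpleGraph.fromRel fun a b =>
    ((a : ℕ) + 1 = (b : ℕ) ∧ (b : ℕ) ≤ n - 5) ∨ ((a : ℕ), (b : ℕ)) ∈ E

/-- The path `v_0 ⋯ v_{n-5}` with two pendant vertices attached at `v_1` and two
at `v_{n-6}`. -/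
def treeT11 (n : ℕ) : SimpleGraph (Fin n) :=
  pathWithEdges n [(1, n - 4), (1, n - 3), (n - 6, n - 2), (n - 6, n - 1)]

/-- The path `v_0 ⋯ v_{n-5}` with a pendant vertex attached at `v_1`, a path of length two
attached at `v_2`, and a pendant vertex attached at `v_{n-6}`. -/
def treeT13 (n : ℕ) : SimpleGraph (Fin n) :=
  pathWithEdges n [(1, n - 4), (2, n - 3), (n - 3, n - 2), (n - 6, n - 1)]

/-- The path `v_0 ⋯ v_{n-5}` with a path of length three attached at `v_3`, and a pendant
vertex attached at `v_{n-6}`. -/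
def treeT18 (n : ℕ) : SimpleGraph (Fin n) :=
  pathWithEdges n [(3, n - 4), (n - 4, n - 3), (n - 3, n - 2), (n - 6, n - 1)]

/-! A diametral path takes the vertices `0, …, d` and leaves four others. Adding these one at a
time, always next to the earliest listed vertex with a neighbour still missing, codes the tree by
four nondecreasing parents `a ≤ b ≤ c ≤ e` (`IsTreeOfDiam.exists_iso_parentTree`).

The Wiener index is that of the path plus `extraSum`. The distances from a path vertex `p` to the
path sum to `F0 - p (d - p)`, and each step away from the path adds `d + 1`; so for a fixed shape of
the four vertices `extraSum` is quadratic in the attaching points. Comparison with the two ends of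
the path shows that a vertex of depth `k` hung at `p` needs `k ≤ p ≤ d - k`. In each of the fourteen
shapes, `4 F0 + 4 d + 12 - extraSum` is at least a combination of nonnegative products plus a slack
depending only on `d`. The slack is `0` for four pendant vertices, `2 (d - 5)` for a path of length
two between pendant vertices or for a star and a pendant vertex, `4 (d - 6)` for a path of length
three and a pendant vertex, `7 (d - 6)` for a fork, and positive otherwise
(`IsPathDist.extraSum_lt_or_isExtremal`).

Equality therefore leaves `treeT11`, and for `d = 5, 6` a few more codes. These come from different
choices and directions of the diametral path in one tree, `treeT13` or `treeT18`, as explicit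
permutations show. -/

/-- The distance between the vertices `i` and `j` of the tree on `ℕ` in which every `k > 0` is
joined to `par k < k`. -/
def recDist (par : ℕ → ℕ) (i j : ℕ) : ℕ :=
  -- The guard `par j < j` makes the recursion terminate for every `par`; it always holds for the
  -- parent functions used below, so the value `0` is reached only for `i = j`.
  if _ : i < j ∧ par j < j then recDist par i (par j) + 1
  else if _ : j < i ∧ par i < i then recDist par (par i) j + 1
  else 0
termination_by i + j
decreasing_by all_goals omega

/-- The graph on `0, …, n - 1` in which every `k > 0` is joined to `par k`. -/
def parentTree (n : ℕ) (par : ℕ → ℕ) : SimpleGraph (Fin n) :=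
  SimpleGraph.fromRel fun a b => 0 < (b : ℕ) ∧ (a : ℕ) = par b

/-! ### Recursive distance for a parent function -/

section recDist

variable {par : ℕ → ℕ} (hpar : ∀ k, 0 < k → par k < k)

theorem recDist_self (i : ℕ) : recDist par i i = 0 := by
  rw [recDist]; simp

include hpar

theorem recDist_of_lt {i j : ℕ} (h : i < j) : recDist par i j = recDist par i (par j) + 1 := by
  conv_lhs => rw [recDist]
  rw [dif_pos ⟨h, hpar j (by omega)⟩]

theorem recDist_of_gt {i j : ℕ} (h : j < i) : recDist par i j = recDist par (par i) j + 1 := by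
  conv_lhs => rw [recDist]
  rw [dif_neg (by omega), dif_pos ⟨h, hpar i (by omega)⟩]

theorem recDist_comm (i j : ℕ) : recDist par i j = recDist par j i := by
  induction h : i + j using Nat.strong_induction_on generalizing i j with
  | _ s ih =>
    rcases lt_trichotomy i j with hij | rfl | hij
    · rw [recDist_of_lt hpar hij, recDist_of_gt hpar hij,
        ih _ (by have := hpar j (by omega); omega) _ _ rfl]
    · rfl
    · rw [recDist_of_gt hpar hij, recDist_of_lt hpar hij,
        ih _ (by have := hpar i (by omega); omega) _ _ rfl]

/-- Moving along an edge changes the distance to a fixed vertex by one. -/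
theorem recDist_parent (i j : ℕ) (hj : 0 < j) :
    recDist par i (par j) = recDist par i j + 1 ∨ recDist par i j = recDist par i (par j) + 1 := by
  induction i using Nat.strong_induction_on with
  | _ i ih =>
    have hpj := hpar j hj
    rcases lt_trichotomy i j with hij | rfl | hij
    · exact Or.inr (recDist_of_lt hpar hij)
    · left
      rw [recDist_of_gt hpar hpj, recDist_self, recDist_self]
    · rw [recDist_of_gt hpar hij, recDist_of_gt hpar (hpj.trans hij)]
      have := ih (par i) (hpar i (by omega))
      omega

end recDist

/-! ### Metric, edges and Wiener index of a parent tree -/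

section parentTree

variable {n : ℕ} {par : ℕ → ℕ}

theorem parentTree_adj {a b : Fin n} : (parentTree n par).Adj a b ↔
    a ≠ b ∧ ((0 < (b : ℕ) ∧ (a : ℕ) = par b) ∨ (0 < (a : ℕ) ∧ (b : ℕ) = par a)) := by
  simp [parentTree]

variable (hpar : ∀ k, 0 < k → par k < k)
include hpar

theorem parentTree_adj_parent {k : ℕ} (hk : k < n) (h0 : 0 < k) :
    (parentTree n par).Adj ⟨par k, (hpar k h0).trans hk⟩ ⟨k, hk⟩ := by
  have := hpar k h0
  rw [parentTree_adj]
  refine ⟨fun h => ?_, Or.inl ⟨h0, rfl⟩⟩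
  simp only [Fin.mk.injEq] at h
  omega

theorem exists_walk_parentTree (i j : ℕ) (hi : i < n) (hj : j < n) :
    ∃ p : (parentTree n par).Walk ⟨i, hi⟩ ⟨j, hj⟩, p.length = recDist par i j := by
  induction h : i + j using Nat.strong_induction_on generalizing i j with
  | _ s ih =>
    rcases lt_trichotomy i j with hij | rfl | hij
    · have hp := hpar j (by omega)
      obtain ⟨p, hl⟩ := ih _ (by omega) i (par j) hi (by omega) rfl
      exact ⟨p.concat (parentTree_adj_parent hpar hj (by omega)), by
        rw [SimpleGraph.Walk.length_concat, hl, recDist_of_lt hpar hij]⟩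
    · exact ⟨.nil, by rw [recDist_self]; rfl⟩
    · have hp := hpar i (by omega)
      obtain ⟨p, hl⟩ := ih _ (by omega) (par i) j (by omega) hj rfl
      exact ⟨.cons (parentTree_adj_parent hpar hi (by omega)).symm p, by
        rw [SimpleGraph.Walk.length_cons, hl, recDist_of_gt hpar hij]⟩

/-- By `recDist_parent` the function changes by exactly one along each edge, so no walk can be
shorter. -/
theorem recDist_le_length {i j : Fin n} (p : (parentTree n par).Walk i j) :
    recDist par i j ≤ p.length := by
  induction p with
  | nil => rw [recDist_self]; simp
  | @cons u v w h p ih =>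
    rw [SimpleGraph.Walk.length_cons, recDist_comm hpar]
    rw [recDist_comm hpar] at ih
    rw [parentTree_adj] at h
    rcases h with ⟨-, ⟨h0, h⟩ | ⟨h0, h⟩⟩
    · have := recDist_parent hpar w v h0
      rw [← h] at this; omega
    · have := recDist_parent hpar w u h0
      rw [← h] at this; omega

theorem parentTree_connected (hn : 0 < n) : (parentTree n par).Connected := by
  have : Nonempty (Fin n) := ⟨⟨0, hn⟩⟩
  exact ⟨fun i j => (exists_walk_parentTree hpar i j i.2 j.2).elim fun p _ => ⟨p⟩⟩

theorem parentTree_dist (i j : Fin n) : (parentTree n par).dist i j = recDist par i j := by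
  apply le_antisymm
  · obtain ⟨p, hp⟩ := exists_walk_parentTree hpar i j i.2 j.2
    exact hp ▸ SimpleGraph.dist_le p
  · obtain ⟨p, hp⟩ := (parentTree_connected hpar i.pos).exists_walk_length_eq_dist i j
    exact hp ▸ recDist_le_length hpar p

theorem parentTree_isTree (hn : 0 < n) : (parentTree n par).IsTree := by
  classical
  have hc := parentTree_connected hpar hn
  rw [SimpleGraph.isTree_iff_connected_and_card]
  refine ⟨hc, le_antisymm ?_ ?_⟩
  · let g : Fin (n - 1) → Sym2 (Fin n) := fun k =>
      s(⟨par (k + 1), (hpar _ (Nat.succ_pos _)).trans (by omega)⟩, ⟨k + 1, by omega⟩)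
    have hsub : (parentTree n par).edgeSet ⊆ Set.range g := by
      intro x hx
      induction x with | _ a b =>
      rw [SimpleGraph.mem_edgeSet, parentTree_adj] at hx
      rcases hx with ⟨-, ⟨h0, h⟩ | ⟨h0, h⟩⟩
      · refine ⟨⟨b - 1, by omega⟩, ?_⟩
        have hb : (b : ℕ) - 1 + 1 = b := by omega
        simp only [g, hb, ← h]
      · refine ⟨⟨a - 1, by omega⟩, ?_⟩
        have hb : (a : ℕ) - 1 + 1 = a := by omega
        simp only [g, hb, ← h]
        exact Sym2.eq_swap
    have h1 : Nat.card (parentTree n par).edgeSet ≤ Nat.card (Set.range g) :=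
      Nat.card_mono (Set.finite_range g) hsub
    have h2 : Nat.card (Set.range g) ≤ Nat.card (Fin (n - 1)) := Finite.card_range_le g
    simp only [Nat.card_eq_fintype_card, Fintype.card_fin] at *
    omega
  · exact hc.card_vert_le_card_edgeSet_add_one

theorem wienerIndex_parentTree :
    wienerIndex
      (parentTree n par) = ∑ k ∈ Finset.range n, ∑ i ∈ Finset.range k, recDist par i k := by
  have h := sum_dist_eq_two_mul_wienerIndex (parentTree n par)
  simp only [parentTree_dist hpar] at h
  have h1 : ∑ u : Fin n, ∑ v : Fin n, recDist par u v =
      ∑ u ∈ Finset.range n, ∑ v ∈ Finset.range n, recDist par u v := by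
    simp only [Finset.sum_range]
  have h2 : ∀ m, ∑ u ∈ Finset.range m, ∑ v ∈ Finset.range m, recDist par u v =
      2 * ∑ k ∈ Finset.range m, ∑ i ∈ Finset.range k, recDist par i k := by
    intro m
    induction m with
    | zero => simp
    | succ m ih =>
      simp only [Finset.sum_range_succ, Finset.sum_add_distrib, recDist_self, ih]
      simp only [recDist_comm hpar m]
      ring
  rw [h1, h2] at h
  omega

theorem parentTree_ediam_ne_top (hn : 0 < n) : (parentTree n par).ediam ≠ ⊤ := by
  have : Nonempty (Fin n) := ⟨⟨0, hn⟩⟩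
  exact SimpleGraph.connected_iff_ediam_ne_top.1 (parentTree_connected hpar hn)

theorem recDist_le_diam {i j : ℕ} (hi : i < n) (hj : j < n) :
    recDist par i j ≤ (parentTree n par).diam := by
  rw [← parentTree_dist hpar ⟨i, hi⟩ ⟨j, hj⟩]
  exact SimpleGraph.dist_le_diam (parentTree_ediam_ne_top hpar (by omega))

theorem parentTree_diam_le {d : ℕ} (hn : 0 < n)
    (h : ∀ i < n, ∀ j < n, recDist par i j ≤ d) : (parentTree n par).diam ≤ d := by
  have : Nonempty (Fin n) := ⟨⟨0, hn⟩⟩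
  obtain ⟨u, v, huv⟩ := (parentTree n par).exists_dist_eq_diam
  rw [← huv, parentTree_dist hpar]
  exact h u u.2 v v.2

end parentTree

/-! ### Invariance under isomorphism -/

section Iso

variable {V W : Type*} {G : SimpleGraph V} {H : SimpleGraph W}

theorem SimpleGraph.Iso.dist_eq (f : G ≃g H) (u v : V) : H.dist (f u) (f v) = G.dist u v := by
  by_cases h : G.Reachable u v
  · apply le_antisymm
    · obtain ⟨p, hp⟩ := h.exists_walk_length_eq_dist
      rw [← hp, ← SimpleGraph.Walk.length_map f.toHom p]
      exact SimpleGraph.dist_le _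
    · have h' : H.Reachable (f u) (f v) := h.map f.toHom
      obtain ⟨p, hp⟩ := h'.exists_walk_length_eq_dist
      have h2 := SimpleGraph.dist_le (p.map f.symm.toHom)
      rw [SimpleGraph.Walk.length_map, hp] at h2
      simpa using h2
  · have h' : ¬ H.Reachable (f u) (f v) := fun h' => h (by simpa using h'.map f.symm.toHom)
    rw [SimpleGraph.dist_eq_zero_of_not_reachable h, SimpleGraph.dist_eq_zero_of_not_reachable h']

theorem SimpleGraph.Iso.diam_eq [Finite V] (f : G ≃g H) (hG : G.Connected) : H.diam = G.diam := by
  have hH : H.Connected := f.connected_iff.1 hG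
  have := hG.nonempty
  have := hH.nonempty
  have : Finite W := Finite.of_equiv V f.toEquiv
  apply le_antisymm
  · obtain ⟨u, v, h⟩ := H.exists_dist_eq_diam
    rw [← h, ← f.symm.dist_eq]
    exact SimpleGraph.dist_le_diam (SimpleGraph.connected_iff_ediam_ne_top.1 hG)
  · obtain ⟨u, v, h⟩ := G.exists_dist_eq_diam
    rw [← h, ← f.dist_eq]
    exact SimpleGraph.dist_le_diam (SimpleGraph.connected_iff_ediam_ne_top.1 hH)

variable [Fintype V] [Fintype W]

theorem SimpleGraph.Iso.wienerIndex_eq (f : G ≃g H) : wienerIndex H = wienerIndex G := by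
  have h1 := sum_dist_eq_two_mul_wienerIndex G
  have h2 := sum_dist_eq_two_mul_wienerIndex H
  have h3 : ∑ u, ∑ v, H.dist u v = ∑ u, ∑ v, G.dist u v := by
    rw [← f.toEquiv.sum_comp]
    refine Finset.sum_congr rfl fun u _ => ?_
    rw [← f.toEquiv.sum_comp]
    exact Finset.sum_congr rfl fun v _ => f.dist_eq u v
  omega

theorem IsTreeOfDiam.of_iso {n d : ℕ} (h : IsTreeOfDiam G n d) (f : G ≃g H) :
    IsTreeOfDiam H n d :=
  ⟨f.isTree_iff.1 h.1, (Fintype.card_congr f.toEquiv).symm.trans h.2.1,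
    (f.diam_eq h.1.connected).trans h.2.2⟩

theorem IsWienerMaximalTree.of_iso {n d : ℕ} (h : IsWienerMaximalTree G n d) (f : G ≃g H) :
    IsWienerMaximalTree H n d :=
  ⟨h.1.of_iso f, fun K hK => f.wienerIndex_eq ▸ h.2 K hK⟩

end Iso

/-! ### Normal form: a path and four further vertices -/

/-- A tree whose vertices are enumerated so that every vertex other than the first one is
adjacent to an earlier one is determined by these adjacencies. -/
theorem SimpleGraph.IsTree.nonempty_iso_parentTree {V : Type*} [Fintype V] {G : SimpleGraph V}
    (hG : G.IsTree) {n : ℕ} (hn : 0 < n) (hcard : Fintype.card V = n) {par : ℕ → ℕ} {f : ℕ → V}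
    (hpar : ∀ k, 0 < k → par k < k) (hf : Set.InjOn f (Set.Iio n))
    (hadj : ∀ k, 0 < k → k < n → G.Adj (f (par k)) (f k)) :
    Nonempty (G ≃g parentTree n par) := by
  have hinj : Function.Injective fun i : Fin n => f i := fun i j h => Fin.ext (hf i.2 j.2 h)
  have hbij : Function.Bijective fun i : Fin n => f i :=
    (Fintype.bijective_iff_injective_and_card _).2 ⟨hinj, by simp [hcard]⟩
  let e : Fin n ≃ V := Equiv.ofBijective _ hbij
  let i : G.comap e ≃g G := SimpleGraph.Iso.comap e G
  have ht : (G.comap e).IsTree := i.isTree_iff.2 hG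
  have hle : parentTree n par ≤ G.comap e := by
    intro a b hab
    rw [parentTree_adj] at hab
    rw [SimpleGraph.comap_adj]
    change G.Adj (f a) (f b)
    rcases hab with ⟨-, ⟨h0, h⟩ | ⟨h0, h⟩⟩
    · rw [h]; exact hadj b h0 b.2
    · rw [h]; exact (hadj a h0 a.2).symm
  -- A tree is minimal among connected graphs, so a connected spanning subgraph is all of it.
  have heq : G.comap e = parentTree n par :=
    le_antisymm ((SimpleGraph.isTree_iff_minimal_connected.1 ht).2
      (parentTree_connected hpar hn) hle) hle
  exact ⟨heq ▸ i.symm⟩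

/-- A partial enumeration of the vertices of a connected graph extends to a full one in which every
new vertex is adjacent to an earlier one, the positions of these being nondecreasing. -/
theorem SimpleGraph.Connected.exists_extend_enumeration {V : Type*} [Fintype V]
    {G : SimpleGraph V} (hG : G.Connected) {n : ℕ} (hcard : Fintype.card V = n) (r : ℕ) :
    ∀ (m q : ℕ) (f : ℕ → V), m + r = n → 0 < m → Set.InjOn f (Set.Iio m) →
      (∀ j < q, j < m → ∀ v, G.Adj (f j) v → ∃ i < m, f i = v) →
      ∃ (g : ℕ → V) (par : ℕ → ℕ), Set.EqOn g f (Set.Iio m) ∧ Set.InjOn g (Set.Iio n) ∧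
        (∀ k, m ≤ k → k < n → q ≤ par k ∧ par k < k ∧ G.Adj (g (par k)) (g k)) ∧
        ∀ k l, m ≤ k → k ≤ l → l < n → par k ≤ par l := by
  classical
  induction r with
  | zero =>
    intro m q f hm _ hf _
    obtain rfl : m = n := hm
    exact ⟨f, id, Set.eqOn_refl _ _, hf, fun k h1 h2 => by omega, fun k l h1 h2 h3 => by omega⟩
  | succ r ih =>
    intro m q f hm h0 hf hq
    -- A walk from `f 0` to a missing vertex must leave the enumerated set. The least position `p`
    -- where this can happen is the next parent.
    have hex : ∃ p, p < m ∧ ∃ v, G.Adj (f p) v ∧ ∀ i < m, f i ≠ v := by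
      have hlt : ((Finset.range m).image f).card < Fintype.card V :=
        Finset.card_image_le.trans_lt (by rw [Finset.card_range]; omega)
      obtain ⟨w, hw⟩ : ∃ w, w ∉ (Finset.range m).image f := by
        by_contra! h
        exact hlt.ne (by rw [Finset.eq_univ_iff_forall.2 h, Finset.card_univ])
      obtain ⟨p⟩ := hG.preconnected (f 0) w
      obtain ⟨a, -, ha1, ha2⟩ := p.exists_boundary_dart ((Finset.range m).image f : Set V)
        (by simpa using ⟨0, h0, rfl⟩) (by simpa using hw)
      simp only [Finset.coe_image, Finset.coe_range, Set.mem_image, Set.mem_Iio, not_exists,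
        not_and] at ha1 ha2
      obtain ⟨i, hi, hia⟩ := ha1
      exact ⟨i, hi, a.snd, hia ▸ a.adj, ha2⟩
    obtain ⟨hp, v, hpv, hv⟩ := Nat.find_spec hex
    have hmin := fun j => Nat.find_min (m := j) hex
    set p := Nat.find hex
    -- The positions below `q` have no missing neighbours. By minimality the same holds below `p`,
    -- so the induction continues with `p` for `q`, which makes the later parents at least `p`.
    have hqp : q ≤ p := by
      by_contra! h
      obtain ⟨i, hi, h'⟩ := hq p h hp v hpv
      exact hv i hi h'
    have hup : ∀ i, i < m → Function.update f m v i = f i := fun i hi =>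
      Function.update_of_ne (by omega) _ _
    obtain ⟨g, par, hgf, hg, hadj, hmono⟩ := ih (m + 1) p (Function.update f m v) (by omega)
      (by omega) (by
        intro i hi j hj hij
        simp only [Set.mem_Iio] at hi hj
        rcases Nat.lt_succ_iff_lt_or_eq.1 hi with hi' | rfl <;>
          rcases Nat.lt_succ_iff_lt_or_eq.1 hj with hj' | rfl
        · rw [hup i hi', hup j hj'] at hij
          exact hf hi' hj' hij
        · rw [hup i hi', Function.update_self] at hij
          exact absurd hij (hv i hi')
        · rw [hup j hj', Function.update_self] at hij
          exact absurd hij.symm (hv j hj')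
        · rfl) (by
        intro j hj hjm w hw
        have hjm' : j < m := by omega
        rw [hup j hjm'] at hw
        have := hmin j hj
        push Not at this
        obtain ⟨i, hi, hiw⟩ := this hjm' w hw
        exact ⟨i, by omega, (hup i hi).trans hiw⟩)
    have hgf' : Set.EqOn g f (Set.Iio m) := fun i hi =>
      (hgf (show i < m + 1 from Nat.lt_succ_of_lt hi)).trans (hup i hi)
    have hgm : g m = v := (hgf (Nat.lt_succ_self m)).trans (Function.update_self _ _ _)
    refine ⟨g, Function.update par m p, hgf', hg, ?_, ?_⟩
    · intro k hmk hkn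
      rcases hmk.eq_or_lt with rfl | hlt
      · rw [Function.update_self, hgm, hgf' hp]
        exact ⟨hqp, hp, hpv⟩
      · rw [Function.update_of_ne (by omega)]
        obtain ⟨h1, h2, h3⟩ := hadj k hlt hkn
        exact ⟨hqp.trans h1, h2, h3⟩
    · intro k l hmk hkl hln
      rcases hmk.eq_or_lt with rfl | hlt
      · rcases hkl.eq_or_lt with rfl | hlt
        · rfl
        · rw [Function.update_self, Function.update_of_ne (by omega)]
          exact (hadj l hlt hln).1
      · rw [Function.update_of_ne (by omega), Function.update_of_ne (by omega)]
        exact hmono k l hlt hkl hln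

/-- The parents in a tree consisting of the path `0, …, d` and the vertices `d + 1, …, d + 4` with
the parents `a`, `b`, `c`, `e`. -/
def pathParent (d a b c e k : ℕ) : ℕ :=
  if k = d + 1 then a else if k = d + 2 then b else if k = d + 3 then c
  else if k = d + 4 then e else k - 1

theorem pathParent_lt {d a b c e : ℕ} (ha : a ≤ d) (hb : b ≤ d + 1) (hc : c ≤ d + 2)
    (he : e ≤ d + 3) (k : ℕ) (hk : 0 < k) : pathParent d a b c e k < k := by
  unfold pathParent
  split_ifs <;> omega

/-- Every tree with `d + 5` vertices and diameter `d` is obtained from a path by attaching four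
vertices one after the other, to vertices in nondecreasing order. -/
theorem IsTreeOfDiam.exists_iso_parentTree {V : Type*} [Fintype V] {G : SimpleGraph V} {d : ℕ}
    (h : IsTreeOfDiam G (d + 5) d) :
    ∃ a b c e, a ≤ d ∧ b ≤ d + 1 ∧ c ≤ d + 2 ∧ e ≤ d + 3 ∧ a ≤ b ∧ b ≤ c ∧ c ≤ e ∧
      Nonempty (G ≃g parentTree (d + 5) (pathParent d a b c e)) := by
  obtain ⟨hG, hcard, hdiam⟩ := h
  have hne := hG.connected.nonempty
  obtain ⟨u, v, huv⟩ := G.exists_dist_eq_diam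
  obtain ⟨p, hp⟩ := hG.connected.exists_walk_length_eq_dist u v
  have hpath := p.isPath_of_length_eq_dist hp
  have hlen : p.length = d := by rw [hp, huv, hdiam]
  -- With `q = 0` nothing is required of the neighbours of the initial path.
  obtain ⟨g, par, hgf, hg, hadj, hmono⟩ := hG.connected.exists_extend_enumeration hcard 4 (d + 1) 0
    p.getVert (by omega) (by omega)
    (fun i hi j hj hij => hpath.getVert_injOn (by simp at hi ⊢; omega) (by simp at hj ⊢; omega) hij)
    (fun j hj => absurd hj (by omega))
  have h1 := hadj (d + 1) (by omega) (by omega)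
  have h2 := hadj (d + 2) (by omega) (by omega)
  have h3 := hadj (d + 3) (by omega) (by omega)
  have h4 := hadj (d + 4) (by omega) (by omega)
  have hpar : ∀ k, d + 1 ≤ k → k < d + 5 →
      pathParent d (par (d + 1)) (par (d + 2)) (par (d + 3)) (par (d + 4)) k = par k := by
    intro k hk1 hk2
    unfold pathParent
    split_ifs <;> first | omega | simp_all
  refine ⟨par (d + 1), par (d + 2), par (d + 3), par (d + 4), by omega, by omega, by omega,
    by omega, hmono _ _ (by omega) (by omega) (by omega), hmono _ _ (by omega) (by omega)
    (by omega), hmono _ _ (by omega) (by omega) (by omega),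
    hG.nonempty_iso_parentTree (by omega) hcard
      (pathParent_lt (by omega) (by omega) (by omega) (by omega)) hg fun k hk0 hk => ?_⟩
  by_cases hkd : k ≤ d
  · have hkp : pathParent d (par (d + 1)) (par (d + 2)) (par (d + 3)) (par (d + 4)) k = k - 1 := by
      unfold pathParent
      split_ifs <;> omega
    rw [hkp, hgf (show k - 1 < d + 1 by omega), hgf (show k < d + 1 by omega)]
    have := p.adj_getVert_succ (i := k - 1) (by omega)
    rwa [Nat.sub_add_cancel hk0] at this
  · rw [hpar k (by omega) hk]
    exact (hadj k (by omega) hk).2.2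

/-! ### Quadratic inequalities for the attaching points -/

section quadratic

variable {d a b c e : ℤ}

theorem four_leaves_bound (h1 : 1 ≤ a) (hab : a ≤ b) (hbc : b ≤ c) (hce : c ≤ e) (h2 : e ≤ d - 1) :
    3 * (e - a) + (c - b) + 4 ≤ a * (d - a) + b * (d - b) + c * (d - c) + e * (d - e) ∧
    (a * (d - a) + b * (d - b) + c * (d - c) + e * (d - e) ≤ 3 * (e - a) + (c - b) + 4 →
      a = 1 ∧ b = 1 ∧ c = d - 1 ∧ e = d - 1) := by
  -- The four products add up exactly to the difference of the two sides, so equality makes each of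
  -- them vanish.
  have q1 : 0 ≤ (a - 1) * (d + 2 - a) := mul_nonneg (by omega) (by omega)
  have q2 : 0 ≤ (b - 1) * (d - b) := mul_nonneg (by omega) (by omega)
  have q3 : 0 ≤ c * (d - 1 - c) := mul_nonneg (by omega) (by omega)
  have q4 : 0 ≤ (d - 1 - e) * (e + 2) := mul_nonneg (by omega) (by omega)
  refine ⟨by linarith, fun h => ?_⟩
  have z1 : (a - 1) * (d + 2 - a) = 0 := by linarith
  have z2 : (b - 1) * (d - b) = 0 := by linarith
  have z3 : c * (d - 1 - c) = 0 := by linarith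
  have z4 : (d - 1 - e) * (e + 2) = 0 := by linarith
  rw [mul_eq_zero] at z1 z2 z3 z4
  omega

/-- A path of length two attached at `p` between two pendant vertices. -/
theorem middle_branch_bound (hd : 5 ≤ d) {p q r : ℤ} (h1 : 1 ≤ q) (h2 : 2 ≤ p) (h3 : p ≤ d - 2)
    (h4 : r ≤ d - 1) (hqp : q ≤ p) (hpr : p ≤ r) :
    d + 6 + 3 * (r - q) ≤ 2 * (p * (d - p)) + q * (d - q) + r * (d - r) ∧
    (2 * (p * (d - p)) + q * (d - q) + r * (d - r) ≤ d + 6 + 3 * (r - q) →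
      d = 5 ∧ q = 1 ∧ r = 4) := by
  have q1 : 0 ≤ (q - 1) * (d + 2 - q) := mul_nonneg (by omega) (by omega)
  have q2 : 0 ≤ (p - 2) * (d - 2 - p) := mul_nonneg (by omega) (by omega)
  have q4 : 0 ≤ (d - 1 - r) * (r + 2) := mul_nonneg (by omega) (by omega)
  -- The difference is `q1 + 2 q2 + q4 + 2 (d - 5)`, writing each name for its product.
  refine ⟨by linarith, fun h => ?_⟩
  have z0 : d = 5 := by linarith
  have z1 : (q - 1) * (d + 2 - q) = 0 := by linarith
  have z4 : (d - 1 - r) * (r + 2) = 0 := by linarith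
  rw [mul_eq_zero] at z1 z4
  omega

/-- A path of length two attached before the pendant vertices. -/
theorem outer_branch_bound (hd : 5 ≤ d) {p q r : ℤ} (h2 : 2 ≤ p)
    (h4 : r ≤ d - 1) (hpq : p ≤ q) (hqr : q ≤ r) :
    d + 6 + (3 * r + q - 4 * p) < 2 * (p * (d - p)) + q * (d - q) + r * (d - r) := by
  have q1 : 0 ≤ (p - 2) * (d - p) := mul_nonneg (by omega) (by omega)
  have q2 : 0 ≤ q * (d - 1 - q) := mul_nonneg (by omega) (by omega)
  have q4 : 0 ≤ (d - 1 - r) * (r + 2) := mul_nonneg (by omega) (by omega)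
  linarith

/-- A star with two leaves attached at `p`, and a pendant vertex. -/
theorem star_bound (hd : 5 ≤ d) {p q : ℤ} (h2 : 2 ≤ p) (h3 : p ≤ d - 2) (h4 : q ≤ d - 1)
    (hpq : p ≤ q) :
    2 * d + 6 + 3 * (q - p) ≤ 3 * (p * (d - p)) + q * (d - q) ∧
    (3 * (p * (d - p)) + q * (d - q) ≤ 2 * d + 6 + 3 * (q - p) → d = 5 ∧ p = 2 ∧ q = 4) := by
  have q1 : 0 ≤ (p - 2) * (d - 1 - p) := mul_nonneg (by omega) (by omega)
  have q4 : 0 ≤ (d - 1 - q) * (q + 2) := mul_nonneg (by omega) (by omega)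
  refine ⟨by linarith, fun h => ?_⟩
  have z0 : d = 5 := by linarith
  have z1 : (p - 2) * (d - 1 - p) = 0 := by linarith
  have z4 : (d - 1 - q) * (q + 2) = 0 := by linarith
  rw [mul_eq_zero] at z1 z4
  omega

/-- The difference is twice the sum of the two products plus `2 (d - 4)`, hence positive. -/
theorem two_paths_bound (hd : 5 ≤ d) {p q : ℤ} (h2 : 2 ≤ p) (h4 : q ≤ d - 2) (hpq : p ≤ q) :
    2 * d + 8 + 4 * (q - p) < 2 * (p * (d - p)) + 2 * (q * (d - q)) := by
  have q1 : 0 ≤ (p - 2) * (d - p) := mul_nonneg (by omega) (by omega)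
  have q4 : 0 ≤ q * (d - 2 - q) := mul_nonneg (by omega) (by omega)
  linarith

/-- A path of length three attached at `p`, and a pendant vertex. -/
theorem long_path_bound {p q : ℤ} (h2 : 3 ≤ p) (h3 : p ≤ d - 3) (h4 : q ≤ d - 1)
    (hpq : p ≤ q) :
    3 * d + 8 + 3 * (q - p) ≤ 3 * (p * (d - p)) + q * (d - q) ∧
    (3 * (p * (d - p)) + q * (d - q) ≤ 3 * d + 8 + 3 * (q - p) → d = 6 ∧ p = 3 ∧ q = 5) := by
  have q1 : 0 ≤ (p - 3) * (d - 2 - p) := mul_nonneg (by omega) (by omega)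
  have q4 : 0 ≤ (d - 1 - q) * (q + 2) := mul_nonneg (by omega) (by omega)
  -- The difference is `3 q1 + q4 + 4 (d - 6)`, and `3 ≤ p ≤ d - 3` gives `6 ≤ d`.
  refine ⟨by linarith, fun h => ?_⟩
  have z0 : d = 6 := by linarith
  have z4 : (d - 1 - q) * (q + 2) = 0 := by linarith
  rw [mul_eq_zero] at z4
  omega

/-- The concave function `p (d - p)` is smallest at the ends of `[k, d - k]`. This serves the shapes
in which all four vertices hang at one point. -/
theorem mul_sub_ge {k p : ℤ} (h1 : k ≤ p) (h2 : p ≤ d - k) : k * (d - k) ≤ p * (d - p) := by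
  have q1 : 0 ≤ (p - k) * (d - k - p) := mul_nonneg (by omega) (by omega)
  linarith

end quadratic

/-! ### The contribution of the four extra vertices, shape by shape -/

/-- The parameters of the extremal trees. -/
def IsExtremal (d a b c e : ℕ) : Prop :=
  (a = 1 ∧ b = 1 ∧ c = d - 1 ∧ e = d - 1) ∨
  -- The codes listed for `d = 5` all describe `treeT13 10`, those for `d = 6` all describe `treeT18
  -- 11`.
  (d = 5 ∧ ((a = 1 ∧ b = 2 ∧ c = 4 ∧ e = 7) ∨ (a = 1 ∧ b = 3 ∧ c = 4 ∧ e = 7) ∨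
    (a = 1 ∧ b = 3 ∧ c = 7 ∧ e = 7) ∨ (a = 2 ∧ b = 4 ∧ c = 6 ∧ e = 6))) ∨
  (d = 6 ∧ ((a = 1 ∧ b = 3 ∧ c = 8 ∧ e = 9) ∨ (a = 3 ∧ b = 5 ∧ c = 7 ∧ e = 9) ∨
    (a = 3 ∧ b = 7 ∧ c = 8 ∧ e = 8)))

/-- `δ` is the distance in the tree consisting of the path `0, …, d` and the vertices
`d + 1, …, d + 4` with the parents `a`, `b`, `c`, `e`, and `F` is the sum of the distances to the
vertices of the path; the sum is `F0` at the ends. -/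
structure IsPathDist (d a b c e : ℕ) (δ : ℕ → ℕ → ℕ) (F : ℕ → ℤ) (F0 : ℤ) : Prop where
  self : ∀ i, δ i i = 0
  path : ∀ i ≤ d, ∀ j ≤ d, δ i j = (i - j) + (j - i)
  left1 : ∀ q ≤ d, δ (d + 1) q = δ a q + 1
  left2 : ∀ q ≤ d + 1, δ (d + 2) q = δ b q + 1
  left3 : ∀ q ≤ d + 2, δ (d + 3) q = δ c q + 1
  left4 : ∀ q ≤ d + 3, δ (d + 4) q = δ e q + 1
  right1 : ∀ q ≤ d, δ q (d + 1) = δ a q + 1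
  right2 : ∀ q ≤ d + 1, δ q (d + 2) = δ b q + 1
  right3 : ∀ q ≤ d + 2, δ q (d + 3) = δ c q + 1
  right4 : ∀ q ≤ d + 3, δ q (d + 4) = δ e q + 1
  sum0 : ∀ p ≤ d, F p = F0 - p * (d - p)
  sum1 : F (d + 1) = F a + (d + 1)
  sum2 : F (d + 2) = F b + (d + 1)
  sum3 : F (d + 3) = F c + (d + 1)
  sum4 : F (d + 4) = F e + (d + 1)

/-- The contribution to the Wiener index of the vertices `d + 1, …, d + 4`. -/
def extraSum (d : ℕ) (δ : ℕ → ℕ → ℕ) (F : ℕ → ℤ) : ℤ :=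
  F (d + 1) + F (d + 2) + F (d + 3) + F (d + 4) + δ (d + 2) (d + 1) +
    δ (d + 3) (d + 1) + δ (d + 3) (d + 2) + δ (d + 4) (d + 1) + δ (d + 4) (d + 2) +
    δ (d + 4) (d + 3)

namespace IsPathDist

variable {d a b c e : ℕ} {δ : ℕ → ℕ → ℕ} {F : ℕ → ℤ} {F0 : ℤ}

theorem cast_path (h : IsPathDist d a b c e δ F F0) {i j : ℕ} (hij : i ≤ j) (hj : j ≤ d) :
    (δ i j : ℤ) = j - i := by
  rw [h.path i (by omega) j hj]; omega

theorem extraSum_leaves (h : IsPathDist d a b c e δ F F0) (hd : 5 ≤ d) (hab : a ≤ b) (hbc : b ≤ c)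
    (hce : c ≤ e) (he : e ≤ d)
    (hdiam : ∀ i < d + 5, ∀ j < d + 5, δ i j ≤ d) :
    extraSum d δ F < 4 * F0 + 4 * d + 12 ∨
      extraSum d δ F = 4 * F0 + 4 * d + 12 ∧ IsExtremal d a b c e := by
  -- The left side stays folded while the right side becomes a polynomial in `F0`, `d` and the
  -- attaching points.
  have hX : extraSum d δ F = _ := rfl
  conv_rhs at hX => unfold extraSum
  simp (disch := omega) only [h.left2, h.left3, h.left4, h.right1, h.right2, h.right3, h.sum0,
    h.sum1, h.sum2, h.sum3, h.sum4, h.cast_path, Nat.cast_add, Nat.cast_one] at hX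
  -- Distances to the ends `0` and `d` of the path confine the outermost attaching points to `[1, d
  -- - 1]`.
  have l1 := hdiam (d + 1) (by omega) 0 (by omega)
  have r1 := hdiam (d + 1) (by omega) d (by omega)
  have l4 := hdiam (d + 4) (by omega) 0 (by omega)
  have r4 := hdiam (d + 4) (by omega) d (by omega)
  simp (disch := omega) only [h.path, h.left1, h.left4] at l1 r1 l4 r4
  unfold IsExtremal
  obtain ⟨h1, h2⟩ := four_leaves_bound (d := (d : ℤ)) (a := (a : ℤ)) (b := (b : ℤ)) (c := (c : ℤ))
    (e := (e : ℤ)) (by omega) (by omega) (by omega) (by omega) (by omega)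
  rcases lt_or_ge (extraSum d δ F) (4 * F0 + 4 * d + 12) with hlt | hge
  · exact Or.inl hlt
  · have := h2 (by linarith)
    exact Or.inr ⟨by linarith, Or.inl ⟨by omega, by omega, by omega, by omega⟩⟩

theorem extraSum_branch_first (h : IsPathDist d a b c (d + 1) δ F F0) (hd : 5 ≤ d) (hab : a ≤ b)
    (hbc : b ≤ c)
    (hc : c ≤ d)
    (hdiam : ∀ i < d + 5, ∀ j < d + 5, δ i j ≤ d) :
    extraSum d δ F < 4 * F0 + 4 * d + 12 ∨
      extraSum d δ F = 4 * F0 + 4 * d + 12 ∧ IsExtremal d a b c (d + 1) := by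
  have hX : extraSum d δ F = _ := rfl
  conv_rhs at hX => unfold extraSum
  simp (disch := omega) only [h.self, h.left2, h.left3, h.left4, h.right1, h.right2, h.right3,
    h.sum0, h.sum1, h.sum2, h.sum3, h.sum4, h.cast_path, Nat.cast_add, Nat.cast_one, Nat.cast_zero]
    at hX
  have l4 := hdiam (d + 4) (by omega) 0 (by omega)
  have r4 := hdiam (d + 4) (by omega) d (by omega)
  have l3 := hdiam (d + 3) (by omega) 0 (by omega)
  have r3 := hdiam (d + 3) (by omega) d (by omega)
  simp (disch := omega) only [h.path, h.left1, h.left3, h.left4] at l4 r4 l3 r3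
  unfold IsExtremal
  have h1 := outer_branch_bound (d := (d : ℤ)) (p := (a : ℤ)) (q := (b : ℤ)) (r := (c : ℤ))
    (by omega) (by omega) (by omega) (by omega) (by omega)
  left
  linarith

theorem extraSum_branch_middle (h : IsPathDist d a b c (d + 2) δ F F0) (hd : 5 ≤ d) (hab : a ≤ b)
    (hbc : b ≤ c)
    (hc : c ≤ d)
    (hdiam : ∀ i < d + 5, ∀ j < d + 5, δ i j ≤ d) :
    extraSum d δ F < 4 * F0 + 4 * d + 12 ∨
      extraSum d δ F = 4 * F0 + 4 * d + 12 ∧ IsExtremal d a b c (d + 2) := by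
  have hX : extraSum d δ F = _ := rfl
  conv_rhs at hX => unfold extraSum
  simp (disch := omega) only [h.self, h.left2, h.left3, h.left4, h.right1, h.right2, h.right3,
    h.sum0, h.sum1, h.sum2, h.sum3, h.sum4, h.cast_path, Nat.cast_add, Nat.cast_one, Nat.cast_zero]
    at hX
  have l1 := hdiam (d + 1) (by omega) 0 (by omega)
  have r1 := hdiam (d + 1) (by omega) d (by omega)
  have l4 := hdiam (d + 4) (by omega) 0 (by omega)
  have r4 := hdiam (d + 4) (by omega) d (by omega)
  have l3 := hdiam (d + 3) (by omega) 0 (by omega)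
  have r3 := hdiam (d + 3) (by omega) d (by omega)
  simp (disch := omega) only [h.path, h.left1, h.left2, h.left3, h.left4] at l1 r1 l4 r4 l3 r3
  unfold IsExtremal
  -- The branch has depth two, so `2 ≤ b ≤ d - 2`; for `d = 5` both values are extremal, being
  -- mirror images.
  have hb : b = 2 ∨ b = 3 ∨ d ≠ 5 := by omega
  obtain ⟨h1, h2⟩ := middle_branch_bound (d := (d : ℤ)) (p := (b : ℤ)) (q := (a : ℤ)) (r :=
    (c : ℤ)) (by omega) (by omega) (by omega) (by omega) (by omega) (by omega) (by omega)
  rcases lt_or_ge (extraSum d δ F) (4 * F0 + 4 * d + 12) with hlt | hge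
  · exact Or.inl hlt
  · obtain ⟨h3, h4, h5⟩ := h2 (by linarith)
    refine Or.inr ⟨by linarith, Or.inr (Or.inl ⟨by omega, ?_⟩)⟩
    clear hX hge h1 h2 hdiam l1 l3 l4 r1 r3 r4
    omega

theorem extraSum_branch_last (h : IsPathDist d a b c (d + 3) δ F F0) (hd : 5 ≤ d) (hab : a ≤ b)
    (hbc : b ≤ c)
    (hc : c ≤ d)
    (hdiam : ∀ i < d + 5, ∀ j < d + 5, δ i j ≤ d) :
    extraSum d δ F < 4 * F0 + 4 * d + 12 ∨
      extraSum d δ F = 4 * F0 + 4 * d + 12 ∧ IsExtremal d a b c (d + 3) := by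
  have hX : extraSum d δ F = _ := rfl
  conv_rhs at hX => unfold extraSum
  simp (disch := omega) only [h.self, h.left2, h.left3, h.left4, h.right1, h.right2, h.sum0,
    h.sum1, h.sum2, h.sum3, h.sum4, h.cast_path, Nat.cast_add, Nat.cast_one, Nat.cast_zero] at hX
  have l1 := hdiam (d + 1) (by omega) 0 (by omega)
  have r1 := hdiam (d + 1) (by omega) d (by omega)
  have l4 := hdiam (d + 4) (by omega) 0 (by omega)
  have r4 := hdiam (d + 4) (by omega) d (by omega)
  simp (disch := omega) only [h.path, h.left1, h.left3, h.left4] at l1 r1 l4 r4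
  unfold IsExtremal
  -- Reversing the path, `i ↦ d - i`, puts the branch before the pendant vertices.
  have h1 := outer_branch_bound (d := (d : ℤ)) (p := ((d : ℤ) - c)) (q := ((d : ℤ) - b)) (r :=
    ((d : ℤ) - a)) (by omega) (by omega) (by omega) (by omega) (by omega)
  left
  linarith

theorem extraSum_star_first (h : IsPathDist d a b (d + 1) (d + 1) δ F F0) (hd : 5 ≤ d)
    (hab : a ≤ b) (hb : b ≤ d)
    (hdiam : ∀ i < d + 5, ∀ j < d + 5, δ i j ≤ d) :
    extraSum d δ F < 4 * F0 + 4 * d + 12 ∨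
      extraSum d δ F = 4 * F0 + 4 * d + 12 ∧ IsExtremal d a b (d + 1) (d + 1) := by
  have hX : extraSum d δ F = _ := rfl
  conv_rhs at hX => unfold extraSum
  simp (disch := omega) only [h.self, h.left2, h.left3, h.left4, h.right1, h.right2, h.right3,
    h.sum0, h.sum1, h.sum2, h.sum3, h.sum4, h.cast_path, Nat.cast_add, Nat.cast_one, Nat.cast_zero]
    at hX
  have l4 := hdiam (d + 4) (by omega) 0 (by omega)
  have r4 := hdiam (d + 4) (by omega) d (by omega)
  have l2 := hdiam (d + 2) (by omega) 0 (by omega)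
  have r2 := hdiam (d + 2) (by omega) d (by omega)
  simp (disch := omega) only [h.path, h.left1, h.left2, h.left4] at l4 r4 l2 r2
  unfold IsExtremal
  obtain ⟨h1, h2⟩ := star_bound (d := (d : ℤ)) (p := (a : ℤ)) (q := (b : ℤ)) (by omega) (by omega)
    (by omega) (by omega) (by omega)
  rcases lt_or_ge (extraSum d δ F) (4 * F0 + 4 * d + 12) with hlt | hge
  · exact Or.inl hlt
  · have := h2 (by linarith)
    exact Or.inr ⟨by linarith, by omega⟩

theorem extraSum_two_paths (h : IsPathDist d a b (d + 1) (d + 2) δ F F0) (hd : 5 ≤ d)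
    (hab : a ≤ b) (hb : b ≤ d)
    (hdiam : ∀ i < d + 5, ∀ j < d + 5, δ i j ≤ d) :
    extraSum d δ F < 4 * F0 + 4 * d + 12 ∨
      extraSum d δ F = 4 * F0 + 4 * d + 12 ∧ IsExtremal d a b (d + 1) (d + 2) := by
  have hX : extraSum d δ F = _ := rfl
  conv_rhs at hX => unfold extraSum
  simp (disch := omega) only [h.self, h.left2, h.left3, h.left4, h.right1, h.right2, h.right3,
    h.sum0, h.sum1, h.sum2, h.sum3, h.sum4, h.cast_path, Nat.cast_add, Nat.cast_one, Nat.cast_zero]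
    at hX
  have l3 := hdiam (d + 3) (by omega) 0 (by omega)
  have r3 := hdiam (d + 3) (by omega) d (by omega)
  have l4 := hdiam (d + 4) (by omega) 0 (by omega)
  have r4 := hdiam (d + 4) (by omega) d (by omega)
  simp (disch := omega) only [h.path, h.left1, h.left2, h.left3, h.left4] at l3 r3 l4 r4
  unfold IsExtremal
  have h1 := two_paths_bound (d := (d : ℤ)) (p := (a : ℤ)) (q := (b : ℤ)) (by omega) (by omega)
    (by omega) (by omega)
  left
  linarith

theorem extraSum_long_path_first (h : IsPathDist d a b (d + 1) (d + 3) δ F F0) (hd : 5 ≤ d)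
    (hab : a ≤ b) (hb : b ≤ d)
    (hdiam : ∀ i < d + 5, ∀ j < d + 5, δ i j ≤ d) :
    extraSum d δ F < 4 * F0 + 4 * d + 12 ∨
      extraSum d δ F = 4 * F0 + 4 * d + 12 ∧ IsExtremal d a b (d + 1) (d + 3) := by
  have hX : extraSum d δ F = _ := rfl
  conv_rhs at hX => unfold extraSum
  simp (disch := omega) only [h.self, h.left2, h.left3, h.left4, h.right1, h.right2, h.sum0,
    h.sum1, h.sum2, h.sum3, h.sum4, h.cast_path, Nat.cast_add, Nat.cast_one, Nat.cast_zero] at hX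
  have l4 := hdiam (d + 4) (by omega) 0 (by omega)
  have r4 := hdiam (d + 4) (by omega) d (by omega)
  have l2 := hdiam (d + 2) (by omega) 0 (by omega)
  have r2 := hdiam (d + 2) (by omega) d (by omega)
  simp (disch := omega) only [h.path, h.left1, h.left2, h.left3, h.left4] at l4 r4 l2 r2
  unfold IsExtremal
  obtain ⟨h1, h2⟩ := long_path_bound (d := (d : ℤ)) (p := (a : ℤ)) (q := (b : ℤ)) (by omega)
    (by omega) (by omega) (by omega)
  rcases lt_or_ge (extraSum d δ F) (4 * F0 + 4 * d + 12) with hlt | hge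
  · exact Or.inl hlt
  · have := h2 (by linarith)
    exact Or.inr ⟨by linarith, by omega⟩

theorem extraSum_star_last (h : IsPathDist d a b (d + 2) (d + 2) δ F F0) (hd : 5 ≤ d)
    (hab : a ≤ b) (hb : b ≤ d)
    (hdiam : ∀ i < d + 5, ∀ j < d + 5, δ i j ≤ d) :
    extraSum d δ F < 4 * F0 + 4 * d + 12 ∨
      extraSum d δ F = 4 * F0 + 4 * d + 12 ∧ IsExtremal d a b (d + 2) (d + 2) := by
  have hX : extraSum d δ F = _ := rfl
  conv_rhs at hX => unfold extraSum
  simp (disch := omega) only [h.self, h.left2, h.left3, h.left4, h.right1, h.right3, h.sum0,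
    h.sum1, h.sum2, h.sum3, h.sum4, h.cast_path, Nat.cast_add, Nat.cast_one, Nat.cast_zero] at hX
  have l4 := hdiam (d + 4) (by omega) 0 (by omega)
  have r4 := hdiam (d + 4) (by omega) d (by omega)
  have l1 := hdiam (d + 1) (by omega) 0 (by omega)
  have r1 := hdiam (d + 1) (by omega) d (by omega)
  simp (disch := omega) only [h.path, h.left1, h.left2, h.left4] at l4 r4 l1 r1
  unfold IsExtremal
  -- The path is reversed, since here the star is attached after the pendant vertex.
  obtain ⟨h1, h2⟩ := star_bound (d := (d : ℤ)) (p := ((d : ℤ) - b)) (q := ((d : ℤ) - a))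
    (by omega) (by omega) (by omega) (by omega) (by omega)
  rcases lt_or_ge (extraSum d δ F) (4 * F0 + 4 * d + 12) with hlt | hge
  · exact Or.inl hlt
  · have := h2 (by linarith)
    exact Or.inr ⟨by linarith, by omega⟩

theorem extraSum_long_path_last (h : IsPathDist d a b (d + 2) (d + 3) δ F F0) (hd : 5 ≤ d)
    (hab : a ≤ b) (hb : b ≤ d)
    (hdiam : ∀ i < d + 5, ∀ j < d + 5, δ i j ≤ d) :
    extraSum d δ F < 4 * F0 + 4 * d + 12 ∨
      extraSum d δ F = 4 * F0 + 4 * d + 12 ∧ IsExtremal d a b (d + 2) (d + 3) := by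
  have hX : extraSum d δ F = _ := rfl
  conv_rhs at hX => unfold extraSum
  simp (disch := omega) only [h.self, h.left2, h.left3, h.left4, h.right1, h.sum0, h.sum1, h.sum2,
    h.sum3, h.sum4, h.cast_path, Nat.cast_add, Nat.cast_one, Nat.cast_zero] at hX
  have l4 := hdiam (d + 4) (by omega) 0 (by omega)
  have r4 := hdiam (d + 4) (by omega) d (by omega)
  have l1 := hdiam (d + 1) (by omega) 0 (by omega)
  have r1 := hdiam (d + 1) (by omega) d (by omega)
  simp (disch := omega) only [h.path, h.left1, h.left2, h.left3, h.left4] at l4 r4 l1 r1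
  unfold IsExtremal
  obtain ⟨h1, h2⟩ := long_path_bound (d := (d : ℤ)) (p := ((d : ℤ) - b)) (q := ((d : ℤ) - a))
    (by omega) (by omega) (by omega) (by omega)
  rcases lt_or_ge (extraSum d δ F) (4 * F0 + 4 * d + 12) with hlt | hge
  · exact Or.inl hlt
  · have := h2 (by linarith)
    exact Or.inr ⟨by linarith, by omega⟩

theorem extraSum_three_leaves (h : IsPathDist d a (d + 1) (d + 1) (d + 1) δ F F0) (hd : 5 ≤ d)
    (ha : a ≤ d)
    (hdiam : ∀ i < d + 5, ∀ j < d + 5, δ i j ≤ d) :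
    extraSum d δ F < 4 * F0 + 4 * d + 12 ∨
      extraSum d δ F = 4 * F0 + 4 * d + 12 ∧ IsExtremal d a (d + 1) (d + 1) (d + 1) := by
  have hX : extraSum d δ F = _ := rfl
  conv_rhs at hX => unfold extraSum
  simp (disch := omega) only [h.self, h.left2, h.left3, h.left4, h.right2, h.right3, h.sum0,
    h.sum1, h.sum2, h.sum3, h.sum4, Nat.cast_add, Nat.cast_one, Nat.cast_zero] at hX
  have l4 := hdiam (d + 4) (by omega) 0 (by omega)
  have r4 := hdiam (d + 4) (by omega) d (by omega)
  simp (disch := omega) only [h.path, h.left1, h.left4] at l4 r4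
  unfold IsExtremal
  have h1 := mul_sub_ge (d := (d : ℤ)) (k := 2) (p := (a : ℤ)) (by omega) (by omega)
  have h2 : (2 * 2 : ℤ) ≤ d := by omega
  left
  linarith

theorem extraSum_star_extended (h : IsPathDist d a (d + 1) (d + 1) (d + 2) δ F F0) (hd : 5 ≤ d)
    (ha : a ≤ d)
    (hdiam : ∀ i < d + 5, ∀ j < d + 5, δ i j ≤ d) :
    extraSum d δ F < 4 * F0 + 4 * d + 12 ∨
      extraSum d δ F = 4 * F0 + 4 * d + 12 ∧ IsExtremal d a (d + 1) (d + 1) (d + 2) := by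
  have hX : extraSum d δ F = _ := rfl
  conv_rhs at hX => unfold extraSum
  simp (disch := omega) only [h.self, h.left2, h.left3, h.left4, h.right2, h.right3, h.sum0,
    h.sum1, h.sum2, h.sum3, h.sum4, Nat.cast_add, Nat.cast_one, Nat.cast_zero] at hX
  have l4 := hdiam (d + 4) (by omega) 0 (by omega)
  have r4 := hdiam (d + 4) (by omega) d (by omega)
  simp (disch := omega) only [h.path, h.left1, h.left2, h.left4] at l4 r4
  unfold IsExtremal
  have h1 := mul_sub_ge (d := (d : ℤ)) (k := 3) (p := (a : ℤ)) (by omega) (by omega)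
  have h2 : (2 * 3 : ℤ) ≤ d := by omega
  left
  linarith

theorem extraSum_star_extended' (h : IsPathDist d a (d + 1) (d + 1) (d + 3) δ F F0) (hd : 5 ≤ d)
    (ha : a ≤ d)
    (hdiam : ∀ i < d + 5, ∀ j < d + 5, δ i j ≤ d) :
    extraSum d δ F < 4 * F0 + 4 * d + 12 ∨
      extraSum d δ F = 4 * F0 + 4 * d + 12 ∧ IsExtremal d a (d + 1) (d + 1) (d + 3) := by
  have hX : extraSum d δ F = _ := rfl
  conv_rhs at hX => unfold extraSum
  simp (disch := omega) only [h.self, h.left2, h.left3, h.left4, h.right2, h.sum0, h.sum1, h.sum2,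
    h.sum3, h.sum4, Nat.cast_add, Nat.cast_one, Nat.cast_zero] at hX
  have l4 := hdiam (d + 4) (by omega) 0 (by omega)
  have r4 := hdiam (d + 4) (by omega) d (by omega)
  simp (disch := omega) only [h.path, h.left1, h.left3, h.left4] at l4 r4
  unfold IsExtremal
  have h1 := mul_sub_ge (d := (d : ℤ)) (k := 3) (p := (a : ℤ)) (by omega) (by omega)
  have h2 : (2 * 3 : ℤ) ≤ d := by omega
  left
  linarith

theorem extraSum_fork (h : IsPathDist d a (d + 1) (d + 2) (d + 2) δ F F0) (hd : 5 ≤ d) (ha : a ≤ d)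
    (hdiam : ∀ i < d + 5, ∀ j < d + 5, δ i j ≤ d) :
    extraSum d δ F < 4 * F0 + 4 * d + 12 ∨
      extraSum d δ F = 4 * F0 + 4 * d + 12 ∧ IsExtremal d a (d + 1) (d + 2) (d + 2) := by
  have hX : extraSum d δ F = _ := rfl
  conv_rhs at hX => unfold extraSum
  simp (disch := omega) only [h.self, h.left2, h.left3, h.left4, h.right3, h.sum0, h.sum1, h.sum2,
    h.sum3, h.sum4, Nat.cast_add, Nat.cast_one, Nat.cast_zero] at hX
  have l4 := hdiam (d + 4) (by omega) 0 (by omega)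
  have r4 := hdiam (d + 4) (by omega) d (by omega)
  simp (disch := omega) only [h.path, h.left1, h.left2, h.left4] at l4 r4
  unfold IsExtremal
  have h1 := mul_sub_ge (d := (d : ℤ)) (k := 3) (p := (a : ℤ)) (by omega) (by omega)
  rcases lt_or_ge (extraSum d δ F) (4 * F0 + 4 * d + 12) with hlt | hge
  · exact Or.inl hlt
  -- The deficit is at least `7 (d - 6)`, while depth three forces `6 ≤ d`.
  · have h2 : (d : ℤ) ≤ 6 := by linarith
    have h3 : d = 6 := by omega
    obtain rfl : a = 3 := by omega
    subst h3
    exact Or.inr ⟨by rw [hX]; norm_num; ring, by omega⟩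

theorem extraSum_one_path (h : IsPathDist d a (d + 1) (d + 2) (d + 3) δ F F0) (hd : 5 ≤ d)
    (ha : a ≤ d)
    (hdiam : ∀ i < d + 5, ∀ j < d + 5, δ i j ≤ d) :
    extraSum d δ F < 4 * F0 + 4 * d + 12 ∨
      extraSum d δ F = 4 * F0 + 4 * d + 12 ∧ IsExtremal d a (d + 1) (d + 2) (d + 3) := by
  have hX : extraSum d δ F = _ := rfl
  conv_rhs at hX => unfold extraSum
  simp (disch := omega) only [h.self, h.left2, h.left3, h.left4, h.sum0, h.sum1, h.sum2, h.sum3,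
    h.sum4, Nat.cast_add, Nat.cast_one, Nat.cast_zero] at hX
  have l4 := hdiam (d + 4) (by omega) 0 (by omega)
  have r4 := hdiam (d + 4) (by omega) d (by omega)
  simp (disch := omega) only [h.path, h.left1, h.left2, h.left3, h.left4] at l4 r4
  unfold IsExtremal
  have h1 := mul_sub_ge (d := (d : ℤ)) (k := 4) (p := (a : ℤ)) (by omega) (by omega)
  have h2 : (2 * 4 : ℤ) ≤ d := by omega
  left
  linarith

end IsPathDist

/-- The contribution of the four vertices outside the path to the Wiener index is at most that of
two pairs of leaves at the two ends. -/
theorem IsPathDist.extraSum_lt_or_isExtremal {d a b c e : ℕ} {δ : ℕ → ℕ → ℕ} {F : ℕ → ℤ} {F0 : ℤ}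
    (h : IsPathDist d a b c e δ F F0) (hd : 5 ≤ d) (ha : a ≤ d) (hb : b ≤ d + 1)
    (hc : c ≤ d + 2) (he : e ≤ d + 3) (hab : a ≤ b) (hbc : b ≤ c) (hce : c ≤ e)
    (hdiam : ∀ i < d + 5, ∀ j < d + 5, δ i j ≤ d) :
    extraSum d δ F < 4 * F0 + 4 * d + 12 ∨
      extraSum d δ F = 4 * F0 + 4 * d + 12 ∧ IsExtremal d a b c e := by
  by_cases hb' : b ≤ d
  · by_cases hc' : c ≤ d
    · by_cases he' : e ≤ d
      · exact h.extraSum_leaves hd hab hbc hce he' hdiam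
      obtain rfl | rfl | rfl : e = d + 1 ∨ e = d + 2 ∨ e = d + 3 := by omega
      · exact h.extraSum_branch_first hd hab hbc hc' hdiam
      · exact h.extraSum_branch_middle hd hab hbc hc' hdiam
      · exact h.extraSum_branch_last hd hab hbc hc' hdiam
    obtain rfl | rfl : c = d + 1 ∨ c = d + 2 := by omega
    · obtain rfl | rfl | rfl : e = d + 1 ∨ e = d + 2 ∨ e = d + 3 := by omega
      · exact h.extraSum_star_first hd hab hb' hdiam
      · exact h.extraSum_two_paths hd hab hb' hdiam
      · exact h.extraSum_long_path_first hd hab hb' hdiam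
    · obtain rfl | rfl : e = d + 2 ∨ e = d + 3 := by omega
      · exact h.extraSum_star_last hd hab hb' hdiam
      · exact h.extraSum_long_path_last hd hab hb' hdiam
  obtain rfl : b = d + 1 := by omega
  obtain rfl | rfl : c = d + 1 ∨ c = d + 2 := by omega
  · obtain rfl | rfl | rfl : e = d + 1 ∨ e = d + 2 ∨ e = d + 3 := by omega
    · exact h.extraSum_three_leaves hd ha hdiam
    · exact h.extraSum_star_extended hd ha hdiam
    · exact h.extraSum_star_extended' hd ha hdiam
  · obtain rfl | rfl : e = d + 2 ∨ e = d + 3 := by omega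
    · exact h.extraSum_fork hd ha hdiam
    · exact h.extraSum_one_path hd ha hdiam

/-! ### Distances and Wiener index in the normal form -/

section pathParent

variable {d a b c e : ℕ}

theorem pathParent_succ {i : ℕ} (hi : i < d) : pathParent d a b c e (i + 1) = i := by
  unfold pathParent
  split_ifs <;> omega

theorem pathParent_one : pathParent d a b c e (d + 1) = a := by simp [pathParent]

theorem pathParent_two : pathParent d a b c e (d + 2) = b := by simp [pathParent]

theorem pathParent_three : pathParent d a b c e (d + 3) = c := by simp [pathParent]

theorem pathParent_four : pathParent d a b c e (d + 4) = e := by simp [pathParent]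

/-- Lengthening the path by the vertex `d + 1` adds `d + 1 - p` to the distances and `p` to the
product, hence `d + 1` on both sides. -/
theorem sum_dist_path {p d : ℕ} (h : p ≤ d) :
    ∑ i ∈ Finset.range (d + 1), ((i - p) + (p - i)) + p * (d - p) =
      ∑ i ∈ Finset.range (d + 1), i := by
  induction d, h using Nat.le_induction with
  | base =>
    rw [← Finset.sum_range_reflect (fun i => i) (p + 1), Nat.sub_self, mul_zero, add_zero]
    refine Finset.sum_congr rfl fun i hi => ?_
    rw [Finset.mem_range] at hi
    omega
  | succ d h ih =>
    rw [Finset.sum_range_succ, Finset.sum_range_succ _ (d + 1), ← ih, Nat.succ_sub h, Nat.mul_succ]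
    omega

variable (ha : a ≤ d) (hb : b ≤ d + 1) (hc : c ≤ d + 2) (he : e ≤ d + 3)

local notation "δ" => recDist (pathParent d a b c e)

include ha hb hc he

theorem recDist_pathParent_path_of_le (i k : ℕ) (hk : i + k ≤ d) : δ i (i + k) = k := by
  have hpar := pathParent_lt ha hb hc he
  induction k with
  | zero => exact recDist_self i
  | succ k ih =>
    rw [recDist_of_lt hpar (by omega), ← add_assoc, pathParent_succ (by omega), ih (by omega)]

theorem recDist_pathParent_path (i : ℕ) (hi : i ≤ d) (j : ℕ) (hj : j ≤ d) :
    δ i j = (i - j) + (j - i) := by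
  have hpar := pathParent_lt ha hb hc he
  rcases le_total i j with h | h
  · obtain ⟨k, rfl⟩ := Nat.exists_eq_add_of_le h
    rw [recDist_pathParent_path_of_le ha hb hc he i k hj]
    omega
  · obtain ⟨k, rfl⟩ := Nat.exists_eq_add_of_le h
    rw [recDist_comm hpar, recDist_pathParent_path_of_le ha hb hc he j k hi]
    omega

theorem isPathDist_recDist : IsPathDist d a b c e δ
    (fun v => ((∑ i ∈ Finset.range (d + 1), δ i v : ℕ) : ℤ))
    ((∑ i ∈ Finset.range (d + 1), i : ℕ) : ℤ) := by
  have hpar := pathParent_lt ha hb hc he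
  have hcomm := recDist_comm hpar
  have hleft : ∀ k q, q < k → δ k q = δ (pathParent d a b c e k) q + 1 := fun k q h =>
    recDist_of_gt hpar h
  have hright : ∀ k q, q < k → δ q k = δ (pathParent d a b c e k) q + 1 := fun k q h => by
    rw [hcomm, hleft k q h]
  have hsum : ∀ k, d < k → ((∑ i ∈ Finset.range (d + 1), δ i k : ℕ) : ℤ) =
      ((∑ i ∈ Finset.range (d + 1), δ i (pathParent d a b c e k) : ℕ) : ℤ) + (d + 1) := by
    intro k hk
    have : ∑ i ∈ Finset.range (d + 1), δ i k =
        ∑ i ∈ Finset.range (d + 1), δ i (pathParent d a b c e k) + (d + 1) := by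
      rw [Finset.sum_congr rfl fun i hi => recDist_of_lt hpar
        (show i < k by rw [Finset.mem_range] at hi; omega), Finset.sum_add_distrib]
      simp
    rw [this]
    push_cast
    rfl
  refine
    { self := recDist_self
      path := recDist_pathParent_path ha hb hc he
      left1 := fun q hq => by rw [hleft _ _ (by omega), pathParent_one]
      left2 := fun q hq => by rw [hleft _ _ (by omega), pathParent_two]
      left3 := fun q hq => by rw [hleft _ _ (by omega), pathParent_three]
      left4 := fun q hq => by rw [hleft _ _ (by omega), pathParent_four]
      right1 := fun q hq => by rw [hright _ _ (by omega), pathParent_one]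
      right2 := fun q hq => by rw [hright _ _ (by omega), pathParent_two]
      right3 := fun q hq => by rw [hright _ _ (by omega), pathParent_three]
      right4 := fun q hq => by rw [hright _ _ (by omega), pathParent_four]
      sum0 := fun p hp => ?_
      sum1 := by rw [hsum _ (by omega), pathParent_one]
      sum2 := by rw [hsum _ (by omega), pathParent_two]
      sum3 := by rw [hsum _ (by omega), pathParent_three]
      sum4 := by rw [hsum _ (by omega), pathParent_four] }
  have h := sum_dist_path hp
  rw [← h, Finset.sum_congr rfl fun i hi => recDist_pathParent_path ha hb hc he i
    (by rw [Finset.mem_range] at hi; omega) p hp]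
  push_cast [Nat.cast_sub hp]
  ring

theorem wienerIndex_pathParent :
    (wienerIndex (parentTree (d + 5) (pathParent d a b c e)) : ℤ) =
      ((∑ k ∈ Finset.range (d + 1), ∑ i ∈ Finset.range k, (k - i) : ℕ) : ℤ) +
      extraSum d δ (fun v => ((∑ i ∈ Finset.range (d + 1), δ i v : ℕ) : ℤ)) := by
  have hpar := pathParent_lt ha hb hc he
  have hcomm := recDist_comm hpar
  have hP : ∑ k ∈ Finset.range (d + 1), ∑ i ∈ Finset.range k, δ i k =
      ∑ k ∈ Finset.range (d + 1), ∑ i ∈ Finset.range k, (k - i) := by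
    refine Finset.sum_congr rfl fun k hk => Finset.sum_congr rfl fun i hi => ?_
    rw [Finset.mem_range] at hk hi
    rw [recDist_pathParent_path ha hb hc he i (by omega) k (by omega)]
    omega
  rw [wienerIndex_parentTree hpar, ← hP, extraSum]
  simp only [Finset.sum_range_succ _ (d + 4), Finset.sum_range_succ _ (d + 3),
    Finset.sum_range_succ _ (d + 2), Finset.sum_range_succ _ (d + 1)]
  rw [hcomm (d + 2) (d + 1), hcomm (d + 3) (d + 1), hcomm (d + 3) (d + 2), hcomm (d + 4) (d + 1),
    hcomm (d + 4) (d + 2), hcomm (d + 4) (d + 3)]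
  push_cast
  ring

end pathParent

/-! ### The upper bound for all trees of diameter `d` -/

/-- The largest Wiener index of a tree with `d + 5` vertices and diameter `d`. -/
def maxWiener (d : ℕ) : ℕ :=
  ∑ k ∈ Finset.range (d + 1), ∑ i ∈ Finset.range k, (k - i) +
    4 * ∑ i ∈ Finset.range (d + 1), i + 4 * d + 12

theorem wienerIndex_parentTree_lt_or {d a b c e : ℕ} (hd : 5 ≤ d) (ha : a ≤ d) (hb : b ≤ d + 1)
    (hc : c ≤ d + 2) (he : e ≤ d + 3) (hab : a ≤ b) (hbc : b ≤ c) (hce : c ≤ e)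
    (hdiam : (parentTree (d + 5) (pathParent d a b c e)).diam = d) :
    wienerIndex (parentTree (d + 5) (pathParent d a b c e)) < maxWiener d ∨
      wienerIndex (parentTree (d + 5) (pathParent d a b c e)) = maxWiener d ∧
        IsExtremal d a b c e := by
  have hW := wienerIndex_pathParent ha hb hc he
  rcases (isPathDist_recDist ha hb hc he).extraSum_lt_or_isExtremal hd ha hb hc he hab hbc hce
    (fun i hi j hj => (recDist_le_diam (pathParent_lt ha hb hc he) hi hj).trans hdiam.le)
    with h | ⟨h, hext⟩
  · left
    zify [maxWiener]
    push_cast at *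
    linarith
  · right
    refine ⟨?_, hext⟩
    zify [maxWiener]
    push_cast at *
    linarith

theorem IsTreeOfDiam.wienerIndex_lt_or_isExtremal {V : Type*} [Fintype V] {G : SimpleGraph V}
    {d : ℕ} (hd : 5 ≤ d) (h : IsTreeOfDiam G (d + 5) d) :
    wienerIndex G < maxWiener d ∨ wienerIndex G = maxWiener d ∧ ∃ a b c e, IsExtremal d a b c e ∧
      Nonempty (G ≃g parentTree (d + 5) (pathParent d a b c e)) := by
  obtain ⟨a, b, c, e, ha, hb, hc, he, hab, hbc, hce, ⟨f⟩⟩ := h.exists_iso_parentTree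
  rw [← f.wienerIndex_eq]
  rcases wienerIndex_parentTree_lt_or hd ha hb hc he hab hbc hce (h.of_iso f).2.2 with h1 | ⟨h1, h2⟩
  · exact Or.inl h1
  · exact Or.inr ⟨h1, a, b, c, e, h2, ⟨f⟩⟩

theorem IsTreeOfDiam.isWienerMaximalTree_iff {V : Type*} [Fintype V] {G : SimpleGraph V} {d : ℕ}
    (hd : 5 ≤ d) {V₀ : Type*} [Fintype V₀] {G₀ : SimpleGraph V₀} (h₀ : IsTreeOfDiam G₀ (d + 5) d)
    (hW₀ : wienerIndex G₀ = maxWiener d) :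
    IsWienerMaximalTree G (d + 5) d ↔
      IsTreeOfDiam G (d + 5) d ∧ wienerIndex G = maxWiener d := by
  have hle : ∀ {U : Type _} [Fintype U] {H : SimpleGraph U}, IsTreeOfDiam H (d + 5) d →
      wienerIndex H ≤ maxWiener d := fun hH => by
    rcases hH.wienerIndex_lt_or_isExtremal hd with h | ⟨h, -⟩
    · exact h.le
    · exact h.le
  constructor
  · rintro ⟨h1, h2⟩
    -- Maximality is tested only on graphs on `Fin (d + 5)`, so `G₀` is replaced by an isomorphic
    -- parent tree.
    obtain ⟨a, b, c, e, -, -, -, -, -, -, -, ⟨f⟩⟩ := h₀.exists_iso_parentTree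
    have h3 := h2 _ (h₀.of_iso f)
    rw [f.wienerIndex_eq, hW₀] at h3
    rcases h1.wienerIndex_lt_or_isExtremal hd with h | ⟨h, -⟩
    · omega
    · exact ⟨h1, h⟩
  · rintro ⟨h1, h2⟩
    exact ⟨h1, fun H hH => h2 ▸ hle hH⟩

theorem isTreeOfDiam_pathParent {d a b c e : ℕ} (ha : a ≤ d) (hb : b ≤ d + 1) (hc : c ≤ d + 2)
    (he : e ≤ d + 3)
    (hdist : ∀ i < d + 5, ∀ j < d + 5, recDist (pathParent d a b c e) i j ≤ d) :
    IsTreeOfDiam (parentTree (d + 5) (pathParent d a b c e)) (d + 5) d := by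
  have hpar := pathParent_lt ha hb hc he
  refine ⟨parentTree_isTree hpar (by omega), Fintype.card_fin _,
    le_antisymm (parentTree_diam_le hpar (by omega) hdist) ?_⟩
  have h1 := recDist_le_diam (n := d + 5) hpar (i := 0) (j := d) (by omega) (by omega)
  rw [(isPathDist_recDist ha hb hc he).path _ (by omega) _ le_rfl] at h1
  omega

/-! ### Trees attaining the bound -/

section examples

variable {d : ℕ}

/-- Applied to both endpoints, this splits a diameter check into 25 cases with explicit distances.
-/
theorem forall_lt_add_five {P : ℕ → Prop} (h0 : ∀ i ≤ d, P i) (h1 : P (d + 1)) (h2 : P (d + 2))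
    (h3 : P (d + 3)) (h4 : P (d + 4)) (i : ℕ) (hi : i < d + 5) : P i := by
  obtain h | rfl | rfl | rfl | rfl : i ≤ d ∨ i = d + 1 ∨ i = d + 2 ∨ i = d + 3 ∨ i = d + 4 := by
    omega
  exacts [h0 i h, h1, h2, h3, h4]

theorem isPathDist_leaves (hd : 5 ≤ d) : IsPathDist d 1 1 (d - 1) (d - 1) (recDist
    (pathParent d 1 1 (d - 1) (d - 1)))
    (fun v => ((∑ i ∈ Finset.range (d + 1), recDist (pathParent d 1 1 (d - 1)
      (d - 1)) i v : ℕ) : ℤ))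
    ((∑ i ∈ Finset.range (d + 1), i : ℕ) : ℤ) :=
  isPathDist_recDist (by omega) (by omega) (by omega) (by omega)

theorem isTreeOfDiam_leaves (hd : 5 ≤ d) :
    IsTreeOfDiam (parentTree (d + 5) (pathParent d 1 1 (d - 1) (d - 1))) (d + 5) d := by
  have h := isPathDist_leaves hd
  refine isTreeOfDiam_pathParent (by omega) (by omega) (by omega) (by omega) ?_
  refine forall_lt_add_five (fun i hi => ?_) ?_ ?_ ?_ ?_ <;>
    refine forall_lt_add_five (fun j hj => ?_) ?_ ?_ ?_ ?_ <;>
    simp (disch := omega) only [h.self, h.path, h.left1, h.left2, h.left3, h.left4, h.right1,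
      h.right2, h.right3, h.right4] <;> omega

theorem wienerIndex_leaves (hd : 5 ≤ d) :
    (wienerIndex (parentTree (d + 5) (pathParent d 1 1 (d - 1) (d - 1))) : ℤ) = maxWiener d := by
  have h := isPathDist_leaves hd
  have hW := wienerIndex_pathParent (d := d) (a := 1) (b := 1) (c := (d - 1)) (e := (d - 1))
    (by omega) (by omega) (by omega) (by omega)
  unfold extraSum at hW
  simp (disch := omega) only [h.self, h.left2, h.left3, h.left4, h.right1, h.right2, h.right3,
    h.sum0, h.sum1, h.sum2, h.sum3, h.sum4, h.cast_path, Nat.cast_add] at hW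
  have hd' : ((d - 1 : ℕ) : ℤ) = d - 1 := by omega
  rw [hW, maxWiener]
  push_cast [hd']
  ring

theorem isPathDist_branch (hd : 5 ≤ d) : IsPathDist d 1 2 (d - 1) (d + 2) (recDist
    (pathParent d 1 2 (d - 1) (d + 2)))
    (fun v => ((∑ i ∈ Finset.range (d + 1), recDist (pathParent d 1 2 (d - 1)
      (d + 2)) i v : ℕ) : ℤ))
    ((∑ i ∈ Finset.range (d + 1), i : ℕ) : ℤ) :=
  isPathDist_recDist (by omega) (by omega) (by omega) (by omega)

theorem isTreeOfDiam_branch (hd : 5 ≤ d) :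
    IsTreeOfDiam (parentTree (d + 5) (pathParent d 1 2 (d - 1) (d + 2))) (d + 5) d := by
  have h := isPathDist_branch hd
  refine isTreeOfDiam_pathParent (by omega) (by omega) (by omega) (by omega) ?_
  refine forall_lt_add_five (fun i hi => ?_) ?_ ?_ ?_ ?_ <;>
    refine forall_lt_add_five (fun j hj => ?_) ?_ ?_ ?_ ?_ <;>
    simp (disch := omega) only [h.self, h.path, h.left1, h.left2, h.left3, h.left4, h.right1,
      h.right2, h.right3, h.right4] <;> omega

/-- The correction `10 - 2 d` is minus the slack in `middle_branch_bound` and vanishes only for `d =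
5`. -/
theorem wienerIndex_branch (hd : 5 ≤ d) :
    (wienerIndex (parentTree (d + 5) (pathParent d 1 2 (d - 1)
      (d + 2))) : ℤ) = maxWiener d + 10 - 2 * d := by
  have h := isPathDist_branch hd
  have hW := wienerIndex_pathParent (d := d) (a := 1) (b := 2) (c := (d - 1)) (e := (d + 2))
    (by omega) (by omega) (by omega) (by omega)
  unfold extraSum at hW
  simp (disch := omega) only [h.self, h.left2, h.left3, h.left4, h.right1, h.right2, h.right3,
    h.sum0, h.sum1, h.sum2, h.sum3, h.sum4, h.cast_path, Nat.cast_add] at hW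
  have hd' : ((d - 1 : ℕ) : ℤ) = d - 1 := by omega
  rw [hW, maxWiener]
  push_cast [hd']
  ring

theorem isPathDist_long_path (hd : 6 ≤ d) : IsPathDist d 1 3 (d + 2) (d + 3) (recDist
    (pathParent d 1 3 (d + 2) (d + 3)))
    (fun v => ((∑ i ∈ Finset.range (d + 1), recDist (pathParent d 1 3 (d + 2)
      (d + 3)) i v : ℕ) : ℤ))
    ((∑ i ∈ Finset.range (d + 1), i : ℕ) : ℤ) :=
  isPathDist_recDist (by omega) (by omega) (by omega) (by omega)

theorem isTreeOfDiam_long_path (hd : 6 ≤ d) :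
    IsTreeOfDiam (parentTree (d + 5) (pathParent d 1 3 (d + 2) (d + 3))) (d + 5) d := by
  have h := isPathDist_long_path hd
  refine isTreeOfDiam_pathParent (by omega) (by omega) (by omega) (by omega) ?_
  refine forall_lt_add_five (fun i hi => ?_) ?_ ?_ ?_ ?_ <;>
    refine forall_lt_add_five (fun j hj => ?_) ?_ ?_ ?_ ?_ <;>
    simp (disch := omega) only [h.self, h.path, h.left1, h.left2, h.left3, h.left4, h.right1,
      h.right2, h.right3, h.right4] <;> omega

/-- The correction `42 - 7 d` vanishes only for `d = 6`, where this tree is the mirror image of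
`treeT18 11`. -/
theorem wienerIndex_long_path (hd : 6 ≤ d) :
    (wienerIndex (parentTree (d + 5) (pathParent d 1 3 (d + 2)
      (d + 3))) : ℤ) = maxWiener d + 42 - 7 * d := by
  have h := isPathDist_long_path hd
  have hW := wienerIndex_pathParent (d := d) (a := 1) (b := 3) (c := (d + 2)) (e := (d + 3))
    (by omega) (by omega) (by omega) (by omega)
  unfold extraSum at hW
  simp (disch := omega) only [h.self, h.left2, h.left3, h.left4, h.right1, h.sum0, h.sum1, h.sum2,
    h.sum3, h.sum4, h.cast_path, Nat.cast_add] at hW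
  rw [hW, maxWiener]
  push_cast
  ring

end examples

/-! ### Isomorphisms and non-isomorphisms of the extremal trees -/

instance decidablePathWithEdgesAdj (n : ℕ) (E : List (ℕ × ℕ)) :
    DecidableRel (pathWithEdges n E).Adj := fun a b =>
  decidable_of_iff _ (SimpleGraph.fromRel_adj _ a b).symm

instance decidableParentTreeAdj (n : ℕ) (par : ℕ → ℕ) : DecidableRel (parentTree n par).Adj :=
  fun a b => decidable_of_iff _ (SimpleGraph.fromRel_adj _ a b).symm

theorem nonempty_iso_of_injective {n : ℕ} {G H : SimpleGraph (Fin n)} (σ : Fin n → Fin n)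
    (hσ : Function.Injective σ) (h : ∀ a b, H.Adj (σ a) (σ b) ↔ G.Adj a b) : Nonempty (G ≃g H) :=
  ⟨⟨Equiv.ofBijective σ (Finite.injective_iff_bijective.1 hσ), fun {a b} => h a b⟩⟩

theorem parentTree_eq_treeT11 {d : ℕ} (hd : 5 ≤ d) :
    parentTree (d + 5) (pathParent d 1 1 (d - 1) (d - 1)) = treeT11 (d + 5) := by
  ext a b
  have ha := a.2
  have hb := b.2
  simp only [parentTree_adj, treeT11, pathWithEdges, SimpleGraph.fromRel_adj, pathParent,
    List.mem_cons, Prod.mk.injEq, List.not_mem_nil, or_false, ne_eq, Fin.ext_iff]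
  refine and_congr_right fun hab => or_congr ?_ ?_
  · split_ifs <;> omega
  · split_ifs <;> omega

set_option maxRecDepth 100000 in
theorem nonempty_iso_treeT13 :
    Nonempty (parentTree 10 (pathParent 5 1 2 4 7) ≃g treeT13 10) ∧
    Nonempty (parentTree 10 (pathParent 5 1 3 4 7) ≃g treeT13 10) ∧
    Nonempty (parentTree 10 (pathParent 5 1 3 7 7) ≃g treeT13 10) ∧
    Nonempty (parentTree 10 (pathParent 5 2 4 6 6) ≃g treeT13 10) := by
  unfold treeT13
  -- The second map reverses the path; the last two use diametral paths that run through the branch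
  -- of length two at `v_2`.
  exact ⟨nonempty_iso_of_injective ![0, 1, 2, 3, 4, 5, 6, 7, 9, 8] (by decide) (by decide),
    nonempty_iso_of_injective ![5, 4, 3, 2, 1, 0, 9, 7, 6, 8] (by decide) (by decide),
    nonempty_iso_of_injective ![5, 4, 3, 2, 7, 8, 9, 1, 0, 6] (by decide) (by decide),
    nonempty_iso_of_injective ![8, 7, 2, 3, 4, 5, 1, 9, 0, 6] (by decide) (by decide)⟩

set_option maxRecDepth 100000 in
theorem nonempty_iso_treeT18 :
    Nonempty (parentTree 11 (pathParent 6 1 3 8 9) ≃g treeT18 11) ∧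
    Nonempty (parentTree 11 (pathParent 6 3 5 7 9) ≃g treeT18 11) ∧
    Nonempty (parentTree 11 (pathParent 6 3 7 8 8) ≃g treeT18 11) := by
  unfold treeT18
  -- The first map reverses the path; the last one takes the branch at `v_3` as half of the
  -- diametral path, which leaves the forked half outside.
  exact ⟨nonempty_iso_of_injective ![6, 5, 4, 3, 2, 1, 0, 10, 7, 8, 9] (by decide) (by decide),
    nonempty_iso_of_injective ![0, 1, 2, 3, 4, 5, 6, 7, 10, 8, 9] (by decide) (by decide),
    nonempty_iso_of_injective ![0, 1, 2, 3, 7, 8, 9, 4, 5, 6, 10] (by decide) (by decide)⟩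

/-- An isomorphism preserves degrees. -/
theorem isEmpty_iso_of_degree_ne {n : ℕ} {G H : SimpleGraph (Fin n)} [DecidableRel G.Adj]
    [DecidableRel H.Adj] (v : Fin n)
    (h : ∀ w, (Finset.univ.filter (H.Adj w)).card ≠ (Finset.univ.filter (G.Adj v)).card) :
    IsEmpty (G ≃g H) := by
  refine ⟨fun f => h (f v) ?_⟩
  refine (Finset.card_bij (fun a _ => f a) ?_ ?_ ?_).symm
  · intro a ha
    simp only [Finset.mem_filter, Finset.mem_univ, true_and] at ha ⊢
    exact f.map_adj_iff.2 ha
  · intro a _ b _ hab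
    exact f.injective hab
  · intro b hb
    refine ⟨f.symm b, ?_, by simp⟩
    simp only [Finset.mem_filter, Finset.mem_univ, true_and] at hb ⊢
    rw [← f.map_adj_iff]
    simpa using hb

set_option maxRecDepth 100000 in
theorem isEmpty_treeT11_iso_treeT13 : IsEmpty (treeT11 10 ≃g treeT13 10) := by
  unfold treeT11 treeT13
  -- The vertex `1` of `treeT11` has degree four, while all degrees in `treeT13 10` are at most
  -- three.
  exact isEmpty_iso_of_degree_ne 1 (by decide)

set_option maxRecDepth 100000 in
theorem isEmpty_treeT11_iso_treeT18 : IsEmpty (treeT11 11 ≃g treeT18 11) := by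
  unfold treeT11 treeT18
  -- Again degree four occurs in `treeT11` only.
  exact isEmpty_iso_of_degree_ne 1 (by decide)

/-! ### Classification of the maximal trees -/

theorem isWienerMaximalTree_iff {V : Type*} [Fintype V] {G : SimpleGraph V} {d : ℕ} (hd : 5 ≤ d) :
    IsWienerMaximalTree G (d + 5) d ↔ IsTreeOfDiam G (d + 5) d ∧ wienerIndex G = maxWiener d :=
  IsTreeOfDiam.isWienerMaximalTree_iff hd (isTreeOfDiam_leaves hd)
    (by exact_mod_cast wienerIndex_leaves hd)

theorem isWienerMaximalTree_treeT11 {d : ℕ} (hd : 5 ≤ d) :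
    IsWienerMaximalTree (treeT11 (d + 5)) (d + 5) d := by
  rw [← parentTree_eq_treeT11 hd]
  exact (isWienerMaximalTree_iff hd).2
    ⟨isTreeOfDiam_leaves hd, by exact_mod_cast wienerIndex_leaves hd⟩

theorem isWienerMaximalTree_treeT13 : IsWienerMaximalTree (treeT13 10) 10 5 := by
  obtain ⟨f⟩ := nonempty_iso_treeT13.1
  have h : IsTreeOfDiam (parentTree 10 (pathParent 5 1 2 4 7)) 10 5 := isTreeOfDiam_branch le_rfl
  have hW : (wienerIndex (parentTree 10 (pathParent 5 1 2 4 7)) : ℤ) = maxWiener 5 + 10 - 2 * 5 :=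
    wienerIndex_branch (d := 5) le_rfl
  exact ((isWienerMaximalTree_iff le_rfl).2 ⟨h, by omega⟩ :
    IsWienerMaximalTree (parentTree 10 (pathParent 5 1 2 4 7)) (5 + 5) 5).of_iso f

theorem isWienerMaximalTree_treeT18 : IsWienerMaximalTree (treeT18 11) 11 6 := by
  obtain ⟨f⟩ := nonempty_iso_treeT18.1
  have h : IsTreeOfDiam (parentTree 11 (pathParent 6 1 3 8 9)) 11 6 := isTreeOfDiam_long_path le_rfl
  have hW : (wienerIndex (parentTree 11 (pathParent 6 1 3 8 9)) : ℤ) = maxWiener 6 + 42 - 7 * 6 :=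
    wienerIndex_long_path (d := 6) le_rfl
  exact ((isWienerMaximalTree_iff (by omega)).2 ⟨h, by omega⟩ :
    IsWienerMaximalTree (parentTree 11 (pathParent 6 1 3 8 9)) (6 + 5) 6).of_iso f

theorem IsWienerMaximalTree.nonempty_iso {V : Type*} [Fintype V] {G : SimpleGraph V} {d : ℕ}
    (hd : 5 ≤ d) (h : IsWienerMaximalTree G (d + 5) d) :
    Nonempty (G ≃g treeT11 (d + 5)) ∨ (d = 5 ∧ Nonempty (G ≃g treeT13 10)) ∨
      (d = 6 ∧ Nonempty (G ≃g treeT18 11)) := by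
  obtain ⟨h1, h2⟩ := (isWienerMaximalTree_iff hd).1 h
  obtain ⟨a, b, c, e, hext, ⟨f⟩⟩ :=
    (h1.wienerIndex_lt_or_isExtremal hd).resolve_left h2.not_lt |>.2
  rcases hext with ⟨rfl, rfl, rfl, rfl⟩ | ⟨rfl, hext⟩ | ⟨rfl, hext⟩
  · exact Or.inl ⟨parentTree_eq_treeT11 hd ▸ f⟩
  · obtain ⟨⟨g1⟩, ⟨g2⟩, ⟨g3⟩, ⟨g4⟩⟩ := nonempty_iso_treeT13
    refine Or.inr (Or.inl ⟨rfl, ?_⟩)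
    rcases hext with ⟨rfl, rfl, rfl, rfl⟩ | ⟨rfl, rfl, rfl, rfl⟩ | ⟨rfl, rfl, rfl, rfl⟩ |
      ⟨rfl, rfl, rfl, rfl⟩
    exacts [⟨f.trans g1⟩, ⟨f.trans g2⟩, ⟨f.trans g3⟩, ⟨f.trans g4⟩]
  · obtain ⟨⟨g1⟩, ⟨g2⟩, ⟨g3⟩⟩ := nonempty_iso_treeT18
    refine Or.inr (Or.inr ⟨rfl, ?_⟩)
    rcases hext with ⟨rfl, rfl, rfl, rfl⟩ | ⟨rfl, rfl, rfl, rfl⟩ | ⟨rfl, rfl, rfl, rfl⟩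
    exacts [⟨f.trans g1⟩, ⟨f.trans g2⟩, ⟨f.trans g3⟩]

theorem mainTheorem3 {V : Type*} [Fintype V] (G : SimpleGraph V) :
    (∀ n : ℕ, 12 ≤ n →
      (IsWienerMaximalTree G n (n - 5) ↔ Nonempty (G ≃g treeT11 n))) ∧
    (IsWienerMaximalTree G 10 5 ↔
      Nonempty (G ≃g treeT11 10) ∨ Nonempty (G ≃g treeT13 10)) ∧
    (IsWienerMaximalTree G 11 6 ↔
      Nonempty (G ≃g treeT11 11) ∨ Nonempty (G ≃g treeT18 11)) ∧
    IsEmpty (treeT11 10 ≃g treeT13 10) ∧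
    IsEmpty (treeT11 11 ≃g treeT18 11) := by
  refine ⟨fun n hn => ?_, ⟨fun h => ?_, ?_⟩, ⟨fun h => ?_, ?_⟩, isEmpty_treeT11_iso_treeT13,
    isEmpty_treeT11_iso_treeT18⟩
  · obtain ⟨d, rfl⟩ := Nat.exists_eq_add_of_le' (show 5 ≤ n by omega)
    rw [Nat.add_sub_cancel]
    refine ⟨fun h => ?_, fun ⟨f⟩ => (isWienerMaximalTree_treeT11 (by omega)).of_iso f.symm⟩
    rcases h.nonempty_iso (by omega) with h | ⟨rfl, -⟩ | ⟨rfl, -⟩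
    · exact h
    · omega
    · omega
  · rcases IsWienerMaximalTree.nonempty_iso (d := 5) le_rfl h with h | ⟨-, h⟩ | ⟨h, -⟩
    · exact Or.inl h
    · exact Or.inr h
    · omega
  · rintro (⟨⟨f⟩⟩ | ⟨⟨f⟩⟩)
    · exact (isWienerMaximalTree_treeT11 (d := 5) le_rfl).of_iso f.symm
    · exact isWienerMaximalTree_treeT13.of_iso f.symm
  · rcases IsWienerMaximalTree.nonempty_iso (d := 6) (by omega) h with h | ⟨h, -⟩ | ⟨-, h⟩
    · exact Or.inl h
    · omega
    · exact Or.inr h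
  · rintro (⟨⟨f⟩⟩ | ⟨⟨f⟩⟩)
    · exact (isWienerMaximalTree_treeT11 (d := 6) (by omega)).of_iso f.symm
    · exact isWienerMaximalTree_treeT18.of_iso f.symm
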